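/- Let $f:\mathbb{C}\to\mathbb{C}$ be a polynomial of degree at least $2$, and write $f^n$ for its $n$-th iterate, with $f^0=\mathrm{Id}$. Let $I(f)=\{z\in\mathbb{C} : |f^n(z)|\to\infty \text{ as } n\to\infty\}$ be the escaping set of $f$. We say that $f$ has a (weighted) time average near a point $z\in\mathbb{C}$ if there exist a neighborhood $U$ of $z$, a constant $c\in\mathbb{C}$ and a sequence $a_0,a_1,\ldots$ of complex numbers, not identically zero, such that the maps $F_N=\sum_{n=0}^{N}a_n f^n$ converge uniformly on $U$ to the constant function $c$ as $N\to\infty$. If $z\in I(f)$, then $f$ does not have a time average near $z$. -/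

import Mathlib

open Filter Topology

/-- The weighted partial sum `F_N = ∑_{n=0}^{N} a_n f^n`, where `f^n` is the `n`-th iterate of `f`
(so `f^0` is the identity). -/
def weightedSum (f : ℂ → ℂ) (a : ℕ → ℂ) (N : ℕ) (w : ℂ) : ℂ :=
  ∑ n ∈ Finset.range (N + 1), a n * f^[n] w

/-- `f` has a (weighted) time average near `z`: for some neighborhood `U` of `z`, some constant `c`
and some sequence `a` that is not identically zero, the maps `F_N` converge to `c`
uniformly on `U`. -/
def HasTimeAverageNear (f : ℂ → ℂ) (z : ℂ) : Prop :=
  ∃ U ∈ 𝓝 z, ∃ (c : ℂ) (a : ℕ → ℂ), a ≠ 0 ∧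
    TendstoUniformlyOn (weightedSum f a) (fun _ => c) atTop U

/-- The escaping set `I(f)` of all points `z` with `|f^n(z)| → ∞`. -/
def escapingSet (f : ℂ → ℂ) : Set ℂ :=
  {z | Tendsto (fun n : ℕ => ‖f^[n] z‖) atTop atTop}

/-! Let `m` be the first index with `a m ≠ 0`. Near infinity `f` lifts through `exp` to an expanding
map, so some iterate `f^M` takes equal values at distinct points `y`, `y'` arbitrarily near
`f^m(z)`, for infinitely many `y` (`exists_infinite_iterate_eq`). For such a pair the tails of the
weighted sums agree, so equality of the limits leaves a finite relation: `P = ∑ n < M, a (m + n)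
f^n` also takes equal values at `y` and `y'`.

Infinitely many such pairs yield a generic one: `u` transcendental and `v ≠ u` algebraic over
`ℂ(u)`, not separated by `f^M` or `P` (`exists_common_value_of_infinite`). Take a valuation with `u`
at infinity. In `P(v) = P(u)` the last term where the orbits still differ is balanced by terms of
strictly smaller size, so two distinct orbit points are relatively close; but nonconstant
polynomials separate such points, although the orbits later merge
(`sum_iterate_aeval_ne_of_transcendental`). -/

/-! ### Polynomials under a valuation bounded by 1 on constants -/

namespace Valuation

variable {k L Γ : Type*} [Field k] [Field L] [Algebra k L] [LinearOrderedCommGroupWithZero Γ]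

open Polynomial in
theorem map_aeval_le_pow (v : Valuation L Γ) (hv : ∀ c : k, v (algebraMap k L c) ≤ 1) {x : L}
    (hx : 1 ≤ v x) (p : k[X]) {n : ℕ} (hn : p.natDegree ≤ n) : v (aeval x p) ≤ v x ^ n := by
  rw [aeval_eq_sum_range]
  refine v.map_sum_le fun i hi => ?_
  rw [Algebra.smul_def, map_mul, map_pow]
  have hi : i ≤ n := (Nat.lt_succ_iff.1 (Finset.mem_range.1 hi)).trans hn
  calc v (algebraMap k L (p.coeff i)) * v x ^ i ≤ 1 * v x ^ n :=
        mul_le_mul' (hv _) (pow_le_pow_right₀ hx hi)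
    _ = v x ^ n := one_mul _

open Polynomial in
theorem map_aeval_le_one (v : Valuation L Γ) (hv : ∀ c : k, v (algebraMap k L c) ≤ 1) {x : L}
    (hx : v x ≤ 1) (p : k[X]) : v (aeval x p) ≤ 1 := by
  rw [aeval_eq_sum_range]
  refine v.map_sum_le fun i _ => ?_
  rw [Algebra.smul_def, map_mul, map_pow]
  exact mul_le_one' (hv _) (pow_le_one' hx i)

theorem map_algebraMap_eq_one (v : Valuation L Γ) (hv : ∀ c : k, v (algebraMap k L c) ≤ 1)
    {c : k} (hc : c ≠ 0) : v (algebraMap k L c) = 1 := by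
  refine le_antisymm (hv c) ?_
  have h : v (algebraMap k L c) * v (algebraMap k L c⁻¹) = 1 := by
    rw [← map_mul, ← map_mul, mul_inv_cancel₀ hc, map_one, map_one]
  calc (1 : Γ) = v (algebraMap k L c) * v (algebraMap k L c⁻¹) := h.symm
    _ ≤ v (algebraMap k L c) * 1 := mul_le_mul' le_rfl (hv _)
    _ = _ := mul_one _

open Polynomial in
theorem map_aeval_eq_pow (v : Valuation L Γ) (hv : ∀ c : k, v (algebraMap k L c) ≤ 1) {x : L}
    (hx : 1 < v x) {p : k[X]} (hp : p ≠ 0) : v (aeval x p) = v x ^ p.natDegree := by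
  rcases Nat.eq_zero_or_pos p.natDegree with h0 | h0
  · rw [eq_C_of_natDegree_eq_zero h0] at hp ⊢
    rw [aeval_C, natDegree_C, pow_zero]
    exact map_algebraMap_eq_one v hv fun h => hp (by rw [h, C_0])
  · have hlead : v (aeval x (C p.leadingCoeff * X ^ p.natDegree)) = v x ^ p.natDegree := by
      rw [map_mul, aeval_C, map_pow, aeval_X, map_mul, map_pow,
        map_algebraMap_eq_one v hv (leadingCoeff_ne_zero.2 hp), one_mul]
    have hlt : v (aeval x p.eraseLead) < v (aeval x (C p.leadingCoeff * X ^ p.natDegree)) := by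
      rw [hlead]
      exact (map_aeval_le_pow v hv hx.le _ p.eraseLead_natDegree_le).trans_lt
        (pow_lt_pow_right₀ hx (by omega))
    rw [← hlead, ← v.map_add_eq_of_lt_right hlt, ← map_add, eraseLead_add_C_mul_X_pow]

open Polynomial in
/-- A nonconstant polynomial separates distinct large points which are close to each other. -/
theorem aeval_ne_of_map_sub_lt [CharZero k] (v : Valuation L Γ)
    (hv : ∀ c : k, v (algebraMap k L c) ≤ 1) {p q : L} (hp : 1 < v p) (hpq : v (q - p) < v p)
    (hne : q ≠ p) {g : k[X]} (hg : g.natDegree ≠ 0) : aeval q g ≠ aeval p g := by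
  intro heq
  obtain ⟨D, hD⟩ := Nat.exists_eq_succ_of_ne_zero hg
  set h := q - p with hh
  have hh0 : 0 < v h := zero_lt_iff.2 ((v.ne_zero_iff).2 (sub_ne_zero.2 hne))
  have hp0 : 0 < v p := zero_lt_one.trans hp
  set T := taylor p (g.map (algebraMap k L)) with hT
  have hTq : T.eval h = aeval q g := by
    rw [hT, taylor_eval, hh, sub_add_cancel, eval_map_algebraMap]
  have hT0 : T.coeff 0 = aeval p g := by
    rw [hT, taylor_coeff_zero, eval_map_algebraMap]
  have hT1 : v (T.coeff 1) = v p ^ D := by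
    rw [hT, taylor_coeff_one, derivative_map, eval_map_algebraMap, map_aeval_eq_pow v hv hp,
      natDegree_derivative, hD, Nat.succ_sub_one]
    intro h0
    exact hg (derivative_eq_zero.1 h0)
  have hTi : ∀ i, v (T.coeff i) ≤ v p ^ (g.natDegree - i) := by
    intro i
    have : hasseDeriv i (g.map (algebraMap k L)) = (hasseDeriv i g).map (algebraMap k L) := by
      ext n
      simp [hasseDeriv_coeff]
    rw [hT, taylor_coeff, this, eval_map_algebraMap]
    exact map_aeval_le_pow v hv hp.le _ (natDegree_hasseDeriv_le g i)
  have hdeg : T.natDegree < D + 2 := by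
    rw [hT, natDegree_taylor]
    exact (natDegree_map_le).trans_lt (by omega)
  rw [← hTq, eval_eq_sum_range' hdeg, Finset.sum_range_succ', Finset.sum_range_succ', hT0, pow_zero,
    mul_one, add_eq_right] at heq
  -- The linear Taylor term has size exactly `v p ^ D * v h`, since in characteristic zero the
  -- derivative has degree `D`. Each higher term gains factors `v h / v p < 1`.
  have hlt : v (∑ i ∈ Finset.range D, T.coeff (i + 1 + 1) * h ^ (i + 1 + 1)) <
      v (T.coeff (0 + 1) * h ^ (0 + 1)) := by
    have hpos : 0 < v p ^ D * v h := mul_pos (pow_pos hp0 D) hh0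
    have he : v (T.coeff (0 + 1) * h ^ (0 + 1)) = v p ^ D * v h := by
      rw [map_mul, zero_add, hT1, pow_one]
    rw [he]
    refine v.map_sum_lt hpos.ne' fun i hi => ?_
    have hi := Finset.mem_range.1 hi
    rw [map_mul, map_pow]
    calc v (T.coeff (i + 1 + 1)) * v h ^ (i + 1 + 1)
        ≤ v p ^ (g.natDegree - (i + 1 + 1)) * v h ^ (i + 1 + 1) := mul_le_mul' (hTi _) le_rfl
      _ = v p ^ (D - (i + 1)) * (v h ^ (i + 1) * v h) := by
          rw [hD, pow_succ (v h) (i + 1)]; congr 2; omega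
      _ < v p ^ (D - (i + 1)) * (v p ^ (i + 1) * v h) :=
          mul_lt_mul_of_pos_left (mul_lt_mul_of_pos_right
            (pow_lt_pow_left₀ hpq zero_le (Nat.succ_ne_zero i)) hh0) (pow_pos hp0 _)
      _ = v p ^ D * v h := by rw [← mul_assoc, ← pow_add]; congr 2; omega
  have := v.map_add_eq_of_lt_right hlt
  rw [heq, map_zero] at this
  rw [← this] at hlt
  exact not_lt_zero hlt

end Valuation

-- Since `u` is not algebraic, `u⁻¹` is not a unit of `k[u⁻¹]`; a valuation ring dominating this
-- ring with `u⁻¹` a nonunit puts `u` at infinity.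
open Polynomial in
theorem Transcendental.exists_valuationSubring {k L : Type*} [Field k] [Field L] [Algebra k L]
    {u : L} (hu : Transcendental k u) :
    ∃ V : ValuationSubring L, (∀ c : k, algebraMap k L c ∈ V) ∧ u ∉ V := by
  have hu0 : u ≠ 0 := by
    rintro rfl
    exact hu isAlgebraic_zero
  set A := (Algebra.adjoin k {u⁻¹}).toSubring with hA
  have hmem : u⁻¹ ∈ A := Algebra.subset_adjoin rfl
  have hI : Ideal.span {(⟨u⁻¹, hmem⟩ : A)} ≠ ⊤ := by
    intro htop
    obtain ⟨⟨b, hb⟩, hb1⟩ := Ideal.mem_span_singleton'.1 ((Ideal.eq_top_iff_one _).1 htop)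
    have hb1 : b * u⁻¹ = 1 := congrArg Subtype.val hb1
    have hbu : b = u := by
      rw [mul_inv_eq_one₀ hu0] at hb1; exact hb1
    subst hbu
    have hb : b ∈ Algebra.adjoin k {b⁻¹} := hb
    rw [Algebra.adjoin_singleton_eq_range_aeval] at hb
    obtain ⟨p, hp⟩ := hb
    have hinv : ¬ IsAlgebraic k b⁻¹ := fun h => hu (by simpa using h.inv)
    refine hinv ⟨p * X - 1, ?_, ?_⟩
    · intro h0
      have := congrArg (eval 0) h0
      simp at this
    · have hp : Polynomial.aeval b⁻¹ p = b := hp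
      simp [hp, hu0]
  obtain ⟨V, hAV, hIV⟩ := Ideal.image_subset_nonunits_valuationSubring _ hI
  refine ⟨V, fun c => hAV ((Algebra.adjoin k {u⁻¹}).algebraMap_mem c), fun huV => ?_⟩
  have : u⁻¹ ∈ V.nonunits := hIV ⟨⟨u⁻¹, hmem⟩, Ideal.mem_span_singleton_self _, rfl⟩
  rw [ValuationSubring.mem_nonunits_iff, map_inv₀] at this
  have h1 := (V.valuation_le_one_iff u).2 huV
  have h2 : (V.valuation u)⁻¹ * V.valuation u < 1 :=
    (mul_le_mul' le_rfl h1).trans_lt (by simpa using this)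
  rw [inv_mul_cancel₀ ((V.valuation.ne_zero_iff).2 hu0)] at h2
  exact lt_irrefl _ h2

open Polynomial in
theorem Polynomial.aeval_iterate_comp_X {k L : Type*} [CommSemiring k] [CommSemiring L]
    [Algebra k L] (f : k[X]) (n : ℕ) (x : L) :
    aeval x (f.comp^[n] X) = (fun y => aeval y f)^[n] x := by
  induction n with
  | zero => simp
  | succ n ih => rw [Function.iterate_succ_apply', aeval_comp, ih, Function.iterate_succ_apply']

open Polynomial in
theorem Polynomial.natDegree_iterate_comp_X {k : Type*} [Field k] (f : k[X]) (n : ℕ) :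
    (f.comp^[n] X).natDegree = f.natDegree ^ n := by
  rw [natDegree_iterate_comp, natDegree_X, mul_one]

/-! ### Generic pairs with common values -/

namespace Polynomial

variable {k : Type*} [Field k]

/-- If `u` is transcendental and `v ≠ u` has a common iterated image with `u`, then the values of
`∑ n < M, b n * f^n` at `u` and `v` differ as soon as `b 0 ≠ 0`. -/
theorem sum_iterate_aeval_ne_of_transcendental [CharZero k] {L : Type*} [Field L] [Algebra k L]
    {f : k[X]} (hf : 2 ≤ f.natDegree) {u v : L} (hu : Transcendental k u) (hvu : v ≠ u) {M : ℕ}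
    (hM : (fun y => aeval y f)^[M] v = (fun y => aeval y f)^[M] u) {b : ℕ → k} (hb : b 0 ≠ 0) :
    ∑ n ∈ Finset.range M, b n • (fun y => aeval y f)^[n] v ≠
      ∑ n ∈ Finset.range M, b n • (fun y => aeval y f)^[n] u := by
  classical
  intro hsum
  obtain ⟨V, hkV, huV⟩ := hu.exists_valuationSubring
  set w := V.valuation with hw
  have hc : ∀ c : k, w (algebraMap k L c) ≤ 1 := fun c => (V.valuation_le_one_iff _).2 (hkV c)
  have hu1 : 1 < w u := not_le.1 fun h => huV ((V.valuation_le_one_iff _).1 h)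
  set F : L → L := fun y => aeval y f with hF
  have hdeg : ∀ n, (f.comp^[n] X).natDegree = f.natDegree ^ n := natDegree_iterate_comp_X f
  have hdpos : ∀ n, 0 < f.natDegree ^ n := fun n => pow_pos (by omega) n
  have hne : ∀ n, f.comp^[n] X ≠ 0 := fun n h0 => by
    have := hdeg n
    rw [h0, natDegree_zero] at this
    exact (hdpos n).ne this
  have hFw : ∀ {x : L}, 1 < w x → ∀ n, w (F^[n] x) = w x ^ f.natDegree ^ n := fun hx n => by
    rw [hF, ← aeval_iterate_comp_X, Valuation.map_aeval_eq_pow w hc hx (hne n), hdeg]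
  have hv1 : 1 < w v := by
    by_contra hv1
    have h1 : w (F^[M] v) ≤ 1 := by
      rw [hF, ← aeval_iterate_comp_X]
      exact Valuation.map_aeval_le_one w hc (not_lt.1 hv1) _
    rw [hM, hFw hu1] at h1
    exact h1.not_gt (one_lt_pow₀ hu1 (hdpos M).ne')
  have huv : w v = w u := by
    have h1 := congrArg w hM
    rw [hFw hu1, hFw hv1] at h1
    exact (pow_left_inj₀ zero_le zero_le (hdpos M).ne').1 h1
  have hex : ∃ n, F^[n] v = F^[n] u := ⟨M, hM⟩
  set K := Nat.find hex with hK
  have hKeq : F^[K] v = F^[K] u := Nat.find_spec hex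
  have hKmin : ∀ n < K, F^[n] v ≠ F^[n] u := fun n hn => Nat.find_min hex hn
  have hKM : K ≤ M := Nat.find_min' hex hM
  have hge : ∀ n, K ≤ n → F^[n] v = F^[n] u := fun n hn => by
    obtain ⟨m, rfl⟩ := Nat.exists_eq_add_of_le' hn
    rw [Function.iterate_add_apply, Function.iterate_add_apply, hKeq]
  have hK0 : 0 < K := Nat.pos_of_ne_zero fun h0 => hvu (by rw [h0] at hKeq; exact hKeq)
  -- Beyond `j`, either the coefficient vanishes or the orbits have merged, so `j` indexes the last
  -- surviving difference.
  set J := (Finset.range K).filter fun n => b n ≠ 0 with hJ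
  have hJne : J.Nonempty := ⟨0, by simp [hJ, hK0, hb]⟩
  set j := J.max' hJne with hj
  have hjJ : j ∈ J := J.max'_mem hJne
  have hjK : j < K := Finset.mem_range.1 (Finset.mem_filter.1 hjJ).1
  have hbj : b j ≠ 0 := (Finset.mem_filter.1 hjJ).2
  have hbig : ∀ n, j < n → b n • F^[n] v - b n • F^[n] u = 0 := fun n hn => by
    rcases lt_or_ge n K with hnK | hnK
    · have : b n = 0 := by
        by_contra h0
        exact hn.not_ge (J.le_max' n (by simp [hJ, hnK, h0]))
      rw [this, zero_smul, zero_smul, sub_zero]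
    · rw [hge n hnK, sub_self]
  have hsum' : ∑ n ∈ Finset.range (j + 1), (b n • F^[n] v - b n • F^[n] u) = 0 := by
    rw [Finset.sum_subset (Finset.range_mono (by omega : j + 1 ≤ M))
      fun n _ hn => hbig n (by simpa using hn), Finset.sum_sub_distrib, hsum, sub_self]
  have hpow : ∀ n, w (F^[n] v - F^[n] u) ≤ w u ^ f.natDegree ^ n := fun n => by
    refine (w.map_sub _ _).trans ?_
    rw [hFw hv1, hFw hu1, huv, max_self]
  have hclose : w (F^[j] v - F^[j] u) < w (F^[j] u) := by
    rw [Finset.sum_range_succ, add_comm, ← smul_sub, add_eq_zero_iff_eq_neg] at hsum'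
    have h1 := congrArg w hsum'
    rw [Valuation.map_neg, Algebra.smul_def, map_mul, Valuation.map_algebraMap_eq_one w hc hbj,
      one_mul] at h1
    rw [h1, hFw hu1]
    refine w.map_sum_lt (pow_pos (zero_lt_one.trans hu1) _).ne' fun n hn => ?_
    rw [← smul_sub, Algebra.smul_def, map_mul]
    calc w (algebraMap k L (b n)) * w (F^[n] v - F^[n] u)
        ≤ 1 * w u ^ f.natDegree ^ n := mul_le_mul' (hc _) (hpow n)
      _ = w u ^ f.natDegree ^ n := one_mul _
      _ < w u ^ f.natDegree ^ j :=
          pow_lt_pow_right₀ hu1 (Nat.pow_lt_pow_right (by omega) (Finset.mem_range.1 hn))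
  have hj1 : 1 < w (F^[j] u) := by
    rw [hFw hu1]
    exact one_lt_pow₀ hu1 (hdpos j).ne'
  refine Valuation.aeval_ne_of_map_sub_lt w hc hj1 hclose (hKmin j hjK)
    (g := f.comp^[K - j] X) (by rw [hdeg]; exact (hdpos _).ne') ?_
  rw [aeval_iterate_comp_X, aeval_iterate_comp_X, ← hF, ← Function.iterate_add_apply,
    ← Function.iterate_add_apply, Nat.sub_add_cancel hjK.le, hKeq]

/-- The divided difference of a polynomial. -/
theorem exists_map_C_sub_C_eq_mul (p : k[X]) :
    ∃ Q : k[X][X], p.map C - C p = (X - C X) * Q := by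
  refine dvd_iff_isRoot.2 ?_
  rw [IsRoot, eval_sub, eval_C, eval_map, eval₂_C_X, sub_self]

/-- The pairs are common zeros of the divided differences `Q₁`, `Q₂`. Their resultant vanishes at
every `y ∈ S`, hence identically, so `Q₁` and `Q₂` share a root `v` over the function field
generated by `u`. -/
theorem exists_common_value_of_infinite [CharZero k] {p₁ p₂ : k[X]} (hp₁ : 2 ≤ p₁.natDegree)
    {S : Set k} (hS : S.Infinite)
    (h : ∀ y ∈ S, ∃ y', y' ≠ y ∧ p₁.eval y' = p₁.eval y ∧ p₂.eval y' = p₂.eval y) :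
    ∃ u v : AlgebraicClosure (RatFunc k), Transcendental k u ∧ v ≠ u ∧
      aeval v p₁ = aeval u p₁ ∧ aeval v p₂ = aeval u p₂ := by
  obtain ⟨Q₁, hQ₁⟩ := exists_map_C_sub_C_eq_mul p₁
  obtain ⟨Q₂, hQ₂⟩ := exists_map_C_sub_C_eq_mul p₂
  have hdeg : Q₁.natDegree ≠ 0 := by
    have h1 := congrArg natDegree hQ₁
    have hQ0 : Q₁ ≠ 0 := by
      rintro rfl
      rw [mul_zero, natDegree_zero, natDegree_sub_C, natDegree_map_eq_of_injective C_injective] at h1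
      omega
    rw [natDegree_sub_C, natDegree_map_eq_of_injective C_injective,
      natDegree_mul (X_sub_C_ne_zero _) hQ0, natDegree_X_sub_C] at h1
    omega
  obtain ⟨A, B, -, -, hAB⟩ := exists_mul_add_mul_eq_C_resultant Q₁ Q₂ le_rfl le_rfl (.inl hdeg)
  have hev : ∀ {p : k[X]} {Q : k[X][X]}, p.map C - C p = (X - C X) * Q → ∀ y y' : k, y' ≠ y →
      p.eval y' = p.eval y → Q.evalEval y y' = 0 := by
    intro p Q hQ y y' hy hp
    have h1 := congrArg (evalEval y y') hQ
    rw [evalEval_mul, evalEval_sub, evalEval_sub, evalEval_map_C, evalEval_C, hp, sub_self,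
      evalEval_X, evalEval_C, eval_X] at h1
    exact (mul_eq_zero.1 h1.symm).resolve_left (sub_ne_zero.2 hy)
  have hres : Q₁.resultant Q₂ = 0 := by
    refine eq_zero_of_infinite_isRoot _ (hS.mono fun y hy => ?_)
    obtain ⟨y', hy', h1, h2⟩ := h y hy
    have h3 := congrArg (evalEval y y') hAB
    rw [evalEval_add, evalEval_mul, evalEval_mul, hev hQ₁ y y' hy' h1, hev hQ₂ y y' hy' h2,
      evalEval_C] at h3
    simpa [IsRoot] using h3.symm
  set ι := algebraMap k[X] (RatFunc k) with hι
  have hιi : Function.Injective ι := IsFractionRing.injective k[X] (RatFunc k)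
  have hcop : ¬ IsCoprime (Q₁.map ι) (Q₂.map ι) := by
    refine (resultant_eq_zero_iff.1 ?_).2
    rw [natDegree_map_eq_of_injective hιi, natDegree_map_eq_of_injective hιi, resultant_map_map,
      hres, map_zero]
  rw [isCoprime_iff_aeval_ne_zero_of_isAlgClosed (RatFunc k) (AlgebraicClosure (RatFunc k))] at hcop
  push Not at hcop
  obtain ⟨v, hv₁, hv₂⟩ := hcop
  set u : AlgebraicClosure (RatFunc k) := algebraMap (RatFunc k) _ RatFunc.X with hudef
  have hu : Transcendental k u :=
    (transcendental_algebraMap_iff (algebraMap (RatFunc k) _).injective).2 RatFunc.transcendental_X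
  set φ : k[X] →+* AlgebraicClosure (RatFunc k) :=
    (algebraMap (RatFunc k) (AlgebraicClosure (RatFunc k))).comp ι with hφ
  have hφX : φ X = u := by
    simp [hφ, hι, hudef]
  have hφC : φ.comp C = algebraMap k (AlgebraicClosure (RatFunc k)) := by
    ext c
    simp [hφ, hι, IsScalarTower.algebraMap_apply k (RatFunc k) (AlgebraicClosure (RatFunc k))]
  have hφp : ∀ p : k[X], φ p = aeval u p := fun p => by
    have : φ = (aeval u : k[X] →ₐ[k] _).toRingHom := by
      refine Polynomial.ringHom_ext' ?_ ?_
      · rw [hφC]; ext c; simp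
      · simp [hφX]
    rw [this]; rfl
  have hφQ : ∀ Q : k[X][X], aeval v (Q.map ι) = Q.eval₂ φ v := fun Q => by
    rw [aeval_def, eval₂_map]
  have hval : ∀ {p : k[X]} {Q : k[X][X]}, p.map C - C p = (X - C X) * Q →
      aeval v (Q.map ι) = 0 → aeval v p = aeval u p := by
    intro p Q hQ h0
    have h1 := congrArg (eval₂ φ v) hQ
    rw [eval₂_mul, ← hφQ Q, h0, mul_zero, eval₂_sub, eval₂_map, hφC, eval₂_C, hφp,
      ← aeval_def, sub_eq_zero] at h1
    exact h1
  refine ⟨u, v, hu, ?_, hval hQ₁ hv₁, hval hQ₂ hv₂⟩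
  -- If `v = u`, differentiating the divided-difference identity on the diagonal gives `p₁'(u) = 0`,
  -- against transcendence.
  rintro rfl
  have h1 := congrArg (eval₂ φ u) (congrArg derivative hQ₁)
  rw [derivative_mul, eval₂_add, eval₂_mul, eval₂_mul, ← hφQ Q₁, hv₁] at h1
  simp only [derivative_sub, derivative_map, derivative_C, sub_zero, eval₂_sub, eval₂_X, eval₂_C,
    hφX, sub_self, mul_zero, zero_mul, add_zero, eval₂_map, hφC, ← aeval_def] at h1
  refine hu ⟨derivative p₁, fun h0 => ?_, h1⟩
  have := derivative_eq_zero.1 h0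
  omega

theorem sum_iterate_eval_ne_of_infinite [CharZero k] {f : k[X]} (hf : 2 ≤ f.natDegree) {M : ℕ}
    {b : ℕ → k} (hb : b 0 ≠ 0) {S : Set k} (hS : S.Infinite)
    (h : ∀ y ∈ S, ∃ y', y' ≠ y ∧ (fun x => f.eval x)^[M] y' = (fun x => f.eval x)^[M] y ∧
      ∑ n ∈ Finset.range M, b n * (fun x => f.eval x)^[n] y' =
        ∑ n ∈ Finset.range M, b n * (fun x => f.eval x)^[n] y) : False := by
  have hM : M ≠ 0 := by
    rintro rfl
    obtain ⟨y, hy⟩ := hS.nonempty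
    obtain ⟨y', hne, heq, -⟩ := h y hy
    exact hne heq
  have hd : 2 ≤ (f.comp^[M] X).natDegree := by
    rw [natDegree_iterate_comp_X]
    exact hf.trans (Nat.le_self_pow hM _)
  obtain ⟨u, v, hu, hne, h1, h2⟩ := exists_common_value_of_infinite (p₁ := f.comp^[M] X)
    (p₂ := ∑ n ∈ Finset.range M, b n • f.comp^[n] X) hd hS (by
      simpa only [iterate_comp_eval, eval_X, eval_finsetSum, eval_smul, smul_eq_mul] using h)
  rw [aeval_iterate_comp_X, aeval_iterate_comp_X] at h1
  simp only [map_sum, map_smul, aeval_iterate_comp_X] at h2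
  exact sum_iterate_aeval_ne_of_transcendental hf hu hne h1 hb h2

end Polynomial

/-! ### Non-injectivity of iterates near escaping points -/

namespace Polynomial

/-- In the logarithmic coordinate, a complex polynomial of degree at least two lifts to an expanding
self-map of a right half plane. -/
theorem exists_expanding_lift {f : Polynomial ℂ} (hf : 2 ≤ f.natDegree) :
    ∃ (T : ℝ) (F : ℂ → ℂ), (∀ t, T < t.re → T < (F t).re) ∧
      (∀ t, T < t.re → DifferentiableAt ℂ F t) ∧
      (∀ t, T < t.re → Complex.exp (F t) = f.eval (Complex.exp t)) ∧
      ∀ s t, T < s.re → T < t.re → 3 / 2 * ‖s - t‖ ≤ ‖F s - F t‖ := by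
  set b := f.leadingCoeff with hb
  have hb0 : b ≠ 0 := leadingCoeff_ne_zero.2 fun h0 => by simp [h0] at hf
  set g : ℂ → ℂ := fun s => f.reverse.eval s / b with hg
  have hgd : Differentiable ℂ g := f.reverse.differentiable.div_const b
  have hg0 : g 0 = 1 := by
    have : f.reverse.eval 0 = b := by rw [← coeff_zero_eq_eval_zero, coeff_zero_reverse]
    simp only [hg, this, div_self hb0]
  have hfg : ∀ t, f.eval (Complex.exp t) =
      Complex.exp (f.natDegree * t) * (b * g (Complex.exp (-t))) := fun t => by
    let := invertibleOfNonzero (Complex.exp_ne_zero t)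
    have h1 := eval₂_reverse_mul_pow (RingHom.id ℂ) (Complex.exp t) f
    rw [invOf_eq_inv, ← Complex.exp_neg, ← Complex.exp_nat_mul, eval₂_id, eval₂_id] at h1
    rw [← h1, mul_div_cancel₀ _ hb0, mul_comm]
  obtain ⟨δ, hδ, hδg⟩ : ∃ δ > 0, ∀ s, ‖s‖ < δ → g s ∈ Complex.slitPlane ∧ ‖Complex.log (g s)‖ ≤ 1 := by
    have h1 : ∀ᶠ s in 𝓝 (0 : ℂ), g s ∈ Complex.slitPlane :=
      hgd.continuous.continuousAt.eventually_mem
        (Complex.isOpen_slitPlane.mem_nhds (by rw [hg0]; exact Complex.one_mem_slitPlane))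
    have h2 : Tendsto (fun s => ‖Complex.log (g s)‖) (𝓝 0) (𝓝 0) := by
      have h3 : ContinuousAt (fun s => ‖Complex.log (g s)‖) 0 :=
        (hgd.continuous.continuousAt.clog (by rw [hg0]; exact Complex.one_mem_slitPlane)).norm
      simpa [ContinuousAt, hg0] using h3
    obtain ⟨δ, hδ, h⟩ := Metric.eventually_nhds_iff.1 (h1.and (h2.eventually_le_const zero_lt_one))
    exact ⟨δ, hδ, fun s hs => h (by simpa using hs)⟩
  set l : ℂ → ℂ := fun t => Complex.log (g (Complex.exp (-t))) with hl
  set T₀ := -Real.log δ with hT₀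
  have hsmall : ∀ t : ℂ, T₀ < t.re → ‖Complex.exp (-t)‖ < δ := fun t ht => by
    rw [Complex.norm_exp, Complex.neg_re, ← Real.lt_log_iff_exp_lt hδ]
    linarith
  have hld : ∀ t : ℂ, T₀ < t.re → DifferentiableAt ℂ l t := fun t ht =>
    (hgd.differentiableAt.comp t (by fun_prop)).clog (hδg _ (hsmall t ht)).1
  have hlb : ∀ t : ℂ, T₀ < t.re → ‖l t‖ ≤ 1 := fun t ht => (hδg _ (hsmall t ht)).2
  -- Cauchy's estimate on a circle of radius 2; the expansion factor is then `2 - 1/2 = 3/2`.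
  have hlderiv : ∀ t : ℂ, T₀ + 2 < t.re → ‖deriv l t‖ ≤ 1 / 2 := fun t ht => by
    have hsub : ∀ s ∈ Metric.closedBall t 2, T₀ < s.re := fun s hs => by
      have h1 : ‖s - t‖ ≤ 2 := by simpa [dist_eq_norm] using hs
      have h2 := (abs_le.1 ((Complex.abs_re_le_norm (s - t)).trans h1)).1
      rw [Complex.sub_re] at h2
      linarith
    refine Complex.norm_deriv_le_of_forall_mem_sphere_norm_le two_pos
      (DifferentiableOn.diffContOnCl fun s hs => ?_)
      fun s hs => hlb s (hsub s (Metric.sphere_subset_closedBall hs))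
    exact (hld s (hsub s (Metric.closure_ball_subset_closedBall hs))).differentiableWithinAt
  have hd2 : (2 : ℝ) ≤ f.natDegree := by exact_mod_cast hf
  set T := max (T₀ + 2) (‖Complex.log b‖ + 1) with hT
  have hT1 : ∀ {t : ℂ}, T < t.re → T₀ + 2 < t.re := (le_max_left _ _).trans_lt
  have hT0 : ∀ {t : ℂ}, T < t.re → T₀ < t.re := fun ht => by have := hT1 ht; linarith
  have hT2 : ∀ {t : ℂ}, T < t.re → ‖Complex.log b‖ + 1 < t.re := (le_max_right _ _).trans_lt
  refine ⟨T, fun t => f.natDegree * t + Complex.log b + l t, fun t ht => ?_, fun t ht => ?_,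
    fun t ht => ?_, fun s t hs ht => ?_⟩
  · have h1 := (abs_le.1 (Complex.abs_re_le_norm (Complex.log b))).1
    have h2 := (abs_le.1 ((Complex.abs_re_le_norm (l t)).trans (hlb t (hT0 ht)))).1
    have h3 := hT2 ht
    have h4 : (0 : ℝ) ≤ t.re := by linarith [norm_nonneg (Complex.log b)]
    have h5 : 2 * t.re ≤ f.natDegree * t.re := mul_le_mul_of_nonneg_right hd2 h4
    have h6 : ((f.natDegree * t + Complex.log b + l t : ℂ)).re =
      f.natDegree * t.re + (Complex.log b).re + (l t).re := by simp
    rw [h6]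
    linarith
  · exact DifferentiableAt.add (by fun_prop) (hld t (hT0 ht))
  · rw [hfg, Complex.exp_add, Complex.exp_add, Complex.exp_log hb0, Complex.exp_log
      (Complex.slitPlane_ne_zero (hδg _ (hsmall t (hT0 ht))).1), mul_assoc]
  · have h1 : ‖l s - l t‖ ≤ 1 / 2 * ‖s - t‖ :=
      Convex.norm_image_sub_le_of_norm_deriv_le (s := {t : ℂ | T < t.re})
        (fun x hx => hld x (hT0 hx)) (fun x hx => hlderiv x (hT1 hx))
        (convex_halfSpace_re_gt T) ht hs
    have h2 : (f.natDegree * s + Complex.log b + l s) - (f.natDegree * t + Complex.log b + l t) =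
      f.natDegree * (s - t) - (l t - l s) := by ring
    have h3 : (2 : ℝ) * ‖s - t‖ ≤ ‖(f.natDegree : ℂ) * (s - t)‖ := by
      rw [norm_mul, Complex.norm_natCast]
      exact mul_le_mul_of_nonneg_right hd2 (norm_nonneg _)
    have h4 := norm_sub_norm_le ((f.natDegree : ℂ) * (s - t)) (l t - l s)
    rw [norm_sub_rev (l t)] at h4
    rw [h2]
    linarith

/-- Near a point of sufficiently large modulus, some iterate of a polynomial of
degree at least two fails to be injective, uniformly on a neighborhood. -/
theorem exists_iterate_eq_of_large {f : Polynomial ℂ} (hf : 2 ≤ f.natDegree) :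
    ∃ R : ℝ, ∀ V : Set ℂ, IsOpen V → ∀ x₀ ∈ V, R < ‖x₀‖ → ∃ n : ℕ, ∃ W : Set ℂ, IsOpen W ∧ x₀ ∈ W ∧
      ∀ x ∈ W, ∃ x' ∈ V, x' ≠ x ∧
        (fun w => f.eval w)^[n] x' = (fun w => f.eval w)^[n] x := by
  obtain ⟨T, F, hFT, hFd, hFe, hFx⟩ := exists_expanding_lift hf
  have hT : ∀ n t, T < t.re → T < (F^[n] t).re := fun n => by
    induction n with
    | zero => exact fun t ht => ht
    | succ n ih => exact fun t ht => by rw [Function.iterate_succ_apply]; exact ih _ (hFT t ht)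
  have hd : ∀ n t, T < t.re → DifferentiableAt ℂ F^[n] t := fun n => by
    induction n with
    | zero => exact fun t _ => differentiableAt_id
    | succ n ih =>
      intro t ht
      rw [Function.iterate_succ]
      exact (ih _ (hFT t ht)).comp t (hFd t ht)
  have he : ∀ n t, T < t.re →
      Complex.exp (F^[n] t) = (fun w => f.eval w)^[n] (Complex.exp t) := fun n => by
    induction n with
    | zero => exact fun t _ => rfl
    | succ n ih =>
      intro t ht
      rw [Function.iterate_succ_apply, Function.iterate_succ_apply, ih _ (hFT t ht), hFe t ht]
  have hx : ∀ n s t, T < s.re → T < t.re → (3 / 2) ^ n * ‖s - t‖ ≤ ‖F^[n] s - F^[n] t‖ := fun n => by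
    induction n with
    | zero => exact fun s t _ _ => by simp
    | succ n ih =>
      intro s t hs ht
      rw [Function.iterate_succ_apply, Function.iterate_succ_apply, pow_succ, mul_assoc]
      exact (mul_le_mul_of_nonneg_left (hFx s t hs ht) (by positivity)).trans
        (ih _ _ (hFT s hs) (hFT t ht))
  refine ⟨Real.exp (T + 1), fun V hV x₀ hx₀ hR => ?_⟩
  have hx₀0 : x₀ ≠ 0 := norm_pos_iff.1 ((Real.exp_pos _).trans hR)
  set t₀ := Complex.log x₀ with ht₀
  have ht₀e : Complex.exp t₀ = x₀ := Complex.exp_log hx₀0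
  have ht₀re : T + 1 < t₀.re := by
    rw [ht₀, Complex.log_re]
    exact (Real.lt_log_iff_exp_lt (norm_pos_iff.2 hx₀0)).2 hR
  obtain ⟨r, hr, hrV⟩ := Metric.isOpen_iff.1 (hV.preimage Complex.continuous_exp) t₀
    (by rw [Set.mem_preimage, ht₀e]; exact hx₀)
  -- Points within `2ε` of `t₀` must stay in the half plane and in the preimage of `V`, and points
  -- within `ε` of each other must be less than one period of `exp` apart.
  set ε := min (r / 2) (1 / 2) with hε
  have hε0 : 0 < ε := lt_min (by linarith) (by norm_num)
  have hεr : ε ≤ r / 2 := min_le_left _ _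
  have hε1 : ε ≤ 1 / 2 := min_le_right _ _
  -- The quantitative open mapping theorem covers a disc of radius `(3/2)^n * ε / 2`, which must
  -- exceed `2π`.
  obtain ⟨n, hn⟩ := pow_unbounded_of_one_lt (4 * Real.pi / ε) (by norm_num : (1 : ℝ) < 3 / 2)
  rw [div_lt_iff₀ hε0] at hn
  refine ⟨n, Complex.exp '' Metric.ball t₀ ε, Complex.isOpenMap_exp _ Metric.isOpen_ball,
    ⟨t₀, Metric.mem_ball_self hε0, ht₀e⟩, ?_⟩
  rintro _ ⟨t, ht, rfl⟩
  have htd : ‖t - t₀‖ < ε := by simpa [dist_eq_norm] using ht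
  have hre : ∀ s : ℂ, ‖s - t₀‖ ≤ 1 → T < s.re := fun s hs => by
    have h1 := (abs_le.1 ((Complex.abs_re_le_norm (s - t₀)).trans hs)).1
    rw [Complex.sub_re] at h1
    linarith
  have hball : ∀ s ∈ Metric.closedBall t ε, ‖s - t₀‖ < ε + ε := fun s hs => by
    have h1 : ‖s - t‖ ≤ ε := by simpa [dist_eq_norm] using hs
    have h2 := norm_add_le (s - t) (t - t₀)
    rw [sub_add_sub_cancel] at h2
    linarith
  have hball' : ∀ s ∈ Metric.closedBall t ε, T < s.re := fun s hs =>
    hre s (by linarith [hball s hs])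
  have htT : T < t.re := hball' t (Metric.mem_closedBall_self hε0.le)
  have hcover := DiffContOnCl.ball_subset_image_closedBall (f := F^[n]) (z₀ := t) (r := ε)
    (ε := (3 / 2) ^ n * ε)
    (DifferentiableOn.diffContOnCl fun s hs =>
      (hd n s (hball' s (Metric.closure_ball_subset_closedBall hs))).differentiableWithinAt) hε0
    (fun s hs => by
      have h1 := hx n s t (hball' s (Metric.sphere_subset_closedBall hs)) htT
      rwa [← dist_eq_norm s t, hs] at h1)
    (by
      have h1 : ∀ᶠ s in 𝓝[≠] t, F^[n] s ≠ F^[n] t := by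
        filter_upwards [self_mem_nhdsWithin,
          nhdsWithin_le_nhds (Metric.closedBall_mem_nhds t hε0)] with s hs hs' heq
        have h2 := hx n s t (hball' s hs') htT
        rw [heq, sub_self, norm_zero] at h2
        have h3 : 0 < (3 / 2 : ℝ) ^ n * ‖s - t‖ :=
          mul_pos (by positivity) (norm_pos_iff.2 (sub_ne_zero.2 hs))
        linarith
      exact h1.frequently.filter_mono nhdsWithin_le_nhds)
  obtain ⟨s, hs, hst⟩ := hcover (show F^[n] t + 2 * Real.pi * Complex.I ∈ _ by
    rw [Metric.mem_ball, dist_eq_norm, add_sub_cancel_left, norm_mul, norm_mul, Complex.norm_I,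
      Complex.norm_real, Real.norm_of_nonneg Real.pi_pos.le, Complex.norm_ofNat]
    linarith)
  refine ⟨Complex.exp s, hrV ?_, fun hexp => ?_, ?_⟩
  · rw [Metric.mem_ball, dist_eq_norm]
    linarith [hball s hs]
  · obtain ⟨m, hm⟩ := Complex.exp_eq_exp_iff_exists_int.1 hexp
    have h1 : ‖s - t‖ ≤ ε := by simpa [dist_eq_norm] using hs
    have h2 : s - t = m * (2 * Real.pi * Complex.I) := by rw [hm]; ring
    rw [h2, norm_mul, norm_mul, norm_mul, Complex.norm_I, Complex.norm_real,
      Real.norm_of_nonneg Real.pi_pos.le, Complex.norm_ofNat, Complex.norm_intCast] at h1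
    have hm0 : m = 0 := by
      by_contra hm0
      have h3 : (1 : ℝ) ≤ |(m : ℝ)| := by exact_mod_cast Int.one_le_abs hm0
      nlinarith [Real.pi_gt_three]
    rw [hm0, Int.cast_zero, zero_mul, add_zero] at hm
    rw [hm, left_eq_add] at hst
    exact Complex.two_pi_I_ne_zero hst
  · rw [← he n s (hball' s hs), ← he n t htT, hst, Complex.exp_add, Complex.exp_two_pi_mul_I,
      mul_one]

theorem isOpenMap_eval {f : Polynomial ℂ} (hf : f.natDegree ≠ 0) :
    IsOpenMap fun w => f.eval w := by
  refine ((AnalyticOnNhd.eval_polynomial f).is_constant_or_isOpenMap).resolve_left ?_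
  rintro ⟨c, hc⟩
  refine hf ?_
  rw [show f = C c from Polynomial.funext fun z => by rw [eval_C]; exact hc z, natDegree_C]

theorem isOpenMap_iterate_eval {f : Polynomial ℂ} (hf : f.natDegree ≠ 0) (n : ℕ) :
    IsOpenMap (fun w => f.eval w)^[n] := by
  induction n with
  | zero => exact IsOpenMap.id
  | succ n ih => rw [Function.iterate_succ]; exact ih.comp (isOpenMap_eval hf)

/-- An iterate carries `z` into the region of large modulus; openness of that iterate lets the
coincident pairs there be pulled back into `V`. -/
theorem exists_infinite_iterate_eq {f : Polynomial ℂ} (hf : 2 ≤ f.natDegree) {V : Set ℂ}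
    (hV : IsOpen V) {z : ℂ} (hzV : z ∈ V) (hz : z ∈ escapingSet fun w => f.eval w) :
    ∃ (M : ℕ) (S : Set ℂ), S.Infinite ∧ S ⊆ V ∧ ∀ y ∈ S, ∃ y' ∈ V, y' ≠ y ∧
      (fun w => f.eval w)^[M] y' = (fun w => f.eval w)^[M] y := by
  obtain ⟨R, hR⟩ := exists_iterate_eq_of_large hf
  obtain ⟨m, hm⟩ := (Tendsto.eventually_gt_atTop hz R).exists
  have hopen : IsOpenMap (fun w => f.eval w)^[m] := isOpenMap_iterate_eval (by omega) m
  obtain ⟨n, W, hW, hzW, h⟩ := hR _ (hopen V hV) _ ⟨z, hzV, rfl⟩ hm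
  refine ⟨n + m, V ∩ (fun w => f.eval w)^[m] ⁻¹' W, ?_, Set.inter_subset_left, ?_⟩
  · exact infinite_of_mem_nhds z
      ((hV.inter (hW.preimage (f.continuous.iterate m))).mem_nhds ⟨hzV, hzW⟩)
  · rintro y ⟨-, hy⟩
    obtain ⟨_, ⟨y', hy'V, rfl⟩, hne, heq⟩ := h _ hy
    refine ⟨y', hy'V, fun h0 => hne (by rw [h0]), ?_⟩
    rw [Function.iterate_add_apply, Function.iterate_add_apply, heq]

end Polynomial

/-! ### From uniform limits to a finite relation -/

theorem weightedSum_add_eq {f : ℂ → ℂ} {a : ℕ → ℂ} {m : ℕ} (ha : ∀ n < m, a n = 0) (M K : ℕ)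
    (y : ℂ) : weightedSum f a (m + M + K) y =
      ∑ n ∈ Finset.range M, a (m + n) * f^[n] (f^[m] y) +
        ∑ n ∈ Finset.range (K + 1), a (m + M + n) * f^[n] (f^[M] (f^[m] y)) := by
  rw [weightedSum, add_assoc (m + M), Finset.sum_range_add, Finset.sum_range_add,
    Finset.sum_eq_zero fun n hn => by rw [ha n (Finset.mem_range.1 hn), zero_mul], zero_add]
  congr 1 <;> refine Finset.sum_congr rfl fun n _ => ?_
  · rw [← Function.iterate_add_apply, add_comm n]
  · rw [← Function.iterate_add_apply, ← Function.iterate_add_apply]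
    congr 2
    omega

/-- Two points with the same limit of weighted sums whose orbits eventually agree satisfy a finite
linear relation. -/
theorem sum_range_iterate_eq_of_tendsto {f : ℂ → ℂ} {a : ℕ → ℂ} {m : ℕ} (ha : ∀ n < m, a n = 0)
    {M : ℕ} {y y' c : ℂ} (hy : Tendsto (fun N => weightedSum f a N y) atTop (𝓝 c))
    (hy' : Tendsto (fun N => weightedSum f a N y') atTop (𝓝 c))
    (h : f^[M] (f^[m] y') = f^[M] (f^[m] y)) :
    ∑ n ∈ Finset.range M, a (m + n) * f^[n] (f^[m] y') =
      ∑ n ∈ Finset.range M, a (m + n) * f^[n] (f^[m] y) := by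
  have h1 : Tendsto (fun K => m + M + K) atTop atTop :=
    tendsto_atTop_mono (fun K => Nat.le_add_left K _) tendsto_id
  have h2 := (hy'.sub hy).comp h1
  rw [sub_self] at h2
  have h3 : (fun N => weightedSum f a N y' - weightedSum f a N y) ∘ (fun K => m + M + K) =
      fun _ => ∑ n ∈ Finset.range M, a (m + n) * f^[n] (f^[m] y') -
        ∑ n ∈ Finset.range M, a (m + n) * f^[n] (f^[m] y) := by
    funext K
    simp only [Function.comp, weightedSum_add_eq ha, h]
    ring
  rw [h3] at h2
  exact sub_eq_zero.1 (tendsto_nhds_unique tendsto_const_nhds h2)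

theorem mainTheorem4 (f : Polynomial ℂ) (hf : 2 ≤ f.natDegree) (z : ℂ)
    (hz : z ∈ escapingSet (fun w => f.eval w)) :
    ¬ HasTimeAverageNear (fun w => f.eval w) z := by
  classical
  rintro ⟨U, hU, c, a, ha, hlim⟩
  set g : ℂ → ℂ := fun w => f.eval w with hg
  obtain ⟨V, hVU, hV, hzV⟩ := mem_nhds_iff.1 hU
  have hex : ∃ n, a n ≠ 0 := Function.ne_iff.1 ha
  set m := Nat.find hex with hm
  have ham : a m ≠ 0 := Nat.find_spec hex
  have hlt : ∀ n < m, a n = 0 := fun n hn => not_not.1 (Nat.find_min hex hn)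
  -- Replacing `z` by `g^[m] z` makes the constant-index coefficient `a m` nonzero, as the algebraic
  -- step requires.
  have hopen : IsOpenMap g^[m] := Polynomial.isOpenMap_iterate_eval (by omega) m
  have hzm : g^[m] z ∈ escapingSet g := by
    have h1 : Tendsto (fun n : ℕ => ‖g^[n + m] z‖) atTop atTop := hz.comp (tendsto_add_atTop_nat m)
    simpa only [escapingSet, Set.mem_ofPred_eq, ← Function.iterate_add_apply] using h1
  obtain ⟨M, S, hS, hSV, h⟩ :=
    Polynomial.exists_infinite_iterate_eq hf (hopen V hV) ⟨z, hzV, rfl⟩ hzm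
  refine Polynomial.sum_iterate_eval_ne_of_infinite hf (b := fun n => a (m + n)) ham hS (M := M)
    fun x hx => ?_
  obtain ⟨_, ⟨y', hy', rfl⟩, hne, heq⟩ := h x hx
  obtain ⟨y, hy, rfl⟩ := hSV hx
  exact ⟨_, hne, heq, sum_range_iterate_eq_of_tendsto hlt (hlim.tendsto_at (hVU hy))
    (hlim.tendsto_at (hVU hy')) heq⟩
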